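/- **(Strong-coupling limit.)** Let $E$ be a finite-dimensional complex Banach space; $\|\cdot\|$ is the operator norm on the linear operators on $E$. Let $\mathcal L_0$ be the generator of a contraction semigroup on $E$, i.e. $\|e^{t\mathcal L_0}\|\le 1$ for all $t\ge 0$, and let $\mathcal D$ be any linear operator on $E$. Let $\mathcal L_0=\sum_k(\alpha_k\mathcal P_k+\mathcal N_k)$ be the spectral representation of $\mathcal L_0$, with distinct eigenvalues $\alpha_k$, spectral projections $\mathcal P_k$ (onto the generalized eigenspace of $\alpha_k$ along the sum of the other generalized eigenspaces) and nilpotents $\mathcal N_k$. Put $\mathcal P_\varphi=\sum_{\alpha_k\in i\mathbb R}\mathcal P_k$, $\mathcal Q_\varphi=1-\mathcal P_\varphi$ and $$\mathcal D_Z=\sum_{\alpha_k\in i\mathbb R}\mathcal P_k\mathcal D\mathcal P_k .$$ Let $m$ be the number of distinct purely imaginary (peripheral) eigenvalues $\alpha_k\in i\mathbb R$ (zero included), $\Delta=\min_{\alpha_k,\alpha_\ell\in i\mathbb R,\,k\ne\ell}|\alpha_k-\alpha_\ell|$ (the term $m(m-1)/\Delta$ below is $0$ if $m\le 1$), $P=\max_{\alpha_k\in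 i\mathbb R}\|\mathcal P_k\|$ ($0$ if $m=0$), and $\eta=\min_{\alpha_k\notin i\mathbb R}|\operatorname{Re}\alpha_k|$ ($\eta=\infty$ and $R/\eta=0$ if all eigenvalues are peripheral). Then: 1. the long-time average exists and equals $\mathcal D_Z$: $$\lim_{\tau\to+\infty}\frac1\tau\int_0^\tau ds\, e^{-s\mathcal L_0}\mathcal P_\varphi\mathcal D\mathcal P_\varphi e^{s\mathcal L_0}=\mathcal D_Z;$$ 2. $e^{t(\kappa\mathcal L_0+\mathcal D)}-e^{t(\kappa\mathcal L_0+\mathcal D_Z)}\to 0$ as $\kappa\to+\infty$, uniformly for $t\in[0,T]$, for every $T\ge 0$; 3. there are constants $R\ge 0$ with $\int_0^\infty ds\,\|e^{s\mathcal L_0}\mathcal Q_\varphi\|\le R/\eta$, and for every such $R$, every $\kappa>0$ and every $t\ge 0$, $$\|e^{t(\kappa\mathcal L_0+\mathcal D)}-e^{t(\kappa\mathcal L_0+\mathcal D_Z)}\|\le\frac2\kappa\Bigl(\frac{m(m-1)}{\Delta}P^2+\frac R\eta\Bigr)\|\mathcal D\|\,e^{t\|\mathcal D_Z\|}\Bigl(1+t\,e^{t\|\mathcal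 D\|}(\|\mathcal D\|+\|\mathcal D_Z\|)\Bigr).$$ -/

import Mathlib

open Filter Topology MeasureTheory
open scoped NNReal ENNReal

namespace StrongCoupling

noncomputable section

variable {E : Type*} [NormedAddCommGroup E] [NormedSpace ℂ E] [FiniteDimensional ℂ E]

/-- `L` generates a contraction semigroup: `‖exp (t L)‖ ≤ 1` for all `t ≥ 0`. -/
def IsContractionGenerator (L : E →L[ℂ] E) : Prop :=
  ∀ t : ℝ, 0 ≤ t → ‖NormedSpace.exp ((t : ℂ) • L)‖ ≤ 1

/-- The generalized eigenspace of `L` at `α` and the sum of all the other generalized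
eigenspaces are complementary. -/
theorem isCompl_maxGenEigenspace (L : E →L[ℂ] E) (α : ℂ) :
    IsCompl (Module.End.maxGenEigenspace (L : E →ₗ[ℂ] E) α)
      (⨆ β : ℂ, ⨆ _ : β ≠ α, Module.End.maxGenEigenspace (L : E →ₗ[ℂ] E) β) := by
  refine ⟨(Module.End.independent_maxGenEigenspace (L : E →ₗ[ℂ] E)) α, ?_⟩
  rw [codisjoint_iff, eq_top_iff, ← Module.End.iSup_maxGenEigenspace_eq_top (L : E →ₗ[ℂ] E)]
  refine iSup_le fun β => ?_
  by_cases h : β = α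
  · subst h
    exact le_sup_left
  · exact le_trans (le_iSup₂_of_le β h le_rfl) le_sup_right

/-- The spectral projection `P_α` of `L` in the spectral representation
`L = ∑ (α P_α + N_α)`: the projection onto the generalized eigenspace at `α` along the sum of
the other generalized eigenspaces. (It is `0` if `α` is not in the spectrum.) -/
def spectralProj (L : E →L[ℂ] E) (α : ℂ) : E →L[ℂ] E :=
  LinearMap.toContinuousLinearMap (Submodule.projection _ _ (isCompl_maxGenEigenspace L α))

/-- The peripheral spectrum of `L`: the part of the spectrum on the imaginary axis. -/
def peripheralSpectrum (L : E →L[ℂ] E) : Set ℂ := {α | α ∈ spectrum ℂ L ∧ α.re = 0}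

theorem finite_peripheralSpectrum (L : E →L[ℂ] E) : (peripheralSpectrum L).Finite := by
  have h : spectrum ℂ L = spectrum ℂ (L : E →ₗ[ℂ] E) :=
    (AlgEquiv.spectrum_eq (Module.End.toContinuousLinearMap (𝕜 := ℂ) E) (L : E →ₗ[ℂ] E))
  refine Set.Finite.subset (s := spectrum ℂ L) ?_ fun α hα => hα.1
  rw [h]
  exact Module.End.finite_spectrum (L : E →ₗ[ℂ] E)

/-- The finite set of the distinct peripheral eigenvalues of `L`. -/
def peripheralEigenvalues (L : E →L[ℂ] E) : Finset ℂ := (finite_peripheralSpectrum L).toFinset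

/-- The peripheral projection `P_φ`, the sum of the peripheral spectral projections. -/
def peripheralProj (L : E →L[ℂ] E) : E →L[ℂ] E :=
  ∑ α ∈ peripheralEigenvalues L, spectralProj L α

/-- The nonperipheral projection `Q_φ = 1 - P_φ`. -/
def nonperipheralProj (L : E →L[ℂ] E) : E →L[ℂ] E := 1 - peripheralProj L

/-- The effective generator `D_Z`, the sum of `P_α D P_α` over the peripheral eigenvalues. -/
def zenoGenerator (L D : E →L[ℂ] E) : E →L[ℂ] E :=
  ∑ α ∈ peripheralEigenvalues L, spectralProj L α * D * spectralProj L α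

/-- The number `m` of distinct peripheral eigenvalues of `L`. -/
def numPeripheral (L : E →L[ℂ] E) : ℕ := (peripheralEigenvalues L).card

/-- The minimal peripheral gap `Δ`: the least distance between two distinct peripheral
eigenvalues (`∞` if there are fewer than two). -/
def peripheralGap (L : E →L[ℂ] E) : ℝ≥0∞ :=
  ⨅ α ∈ peripheralEigenvalues L, ⨅ β ∈ peripheralEigenvalues L, ⨅ _ : α ≠ β,
    ENNReal.ofReal ‖α - β‖

/-- The maximum `P` of the norms of the peripheral spectral projections (`0` if there are
none). -/
def maxProjNorm (L : E →L[ℂ] E) : ℝ≥0 :=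
  (peripheralEigenvalues L).sup fun α => ‖spectralProj L α‖₊

/-- The smallest nonzero decay rate `η`: the least `|Re α|` over the nonperipheral eigenvalues
(`∞` if the spectrum is completely peripheral). -/
def decayRate (L : E →L[ℂ] E) : ℝ≥0∞ :=
  ⨅ α ∈ spectrum ℂ L, ⨅ _ : α.re ≠ 0, ENNReal.ofReal |α.re|

/-- `R` bounds the decaying part of the semigroup:
`∫₀^∞ ‖exp (s L) Q_φ‖ ds ≤ R / η`, where `R / ∞ = 0`. -/
def IsDecayConstant (L : E →L[ℂ] E) (R : ℝ≥0) : Prop :=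
  ∫⁻ s in Set.Ioi (0 : ℝ), ‖NormedSpace.exp ((s : ℂ) • L) * nonperipheralProj L‖ₑ
    ≤ (R : ℝ≥0∞) / decayRate L

end

end StrongCoupling

open StrongCoupling

namespace StrongCoupling

section Semigroup

variable {𝔸 : Type*} [NormedRing 𝔸] [NormedAlgebra ℝ 𝔸]

theorem integral_norm_exp_scaled_le {L Q : 𝔸} {κ I t : ℝ}
    (hI : ∀ T : ℝ, 0 ≤ T → ∫ s in (0 : ℝ)..T, ‖NormedSpace.exp (s • L) * Q‖ ≤ I)
    (hκ : 0 < κ) (ht : 0 ≤ t) :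
    ∫ s in (0 : ℝ)..t, ‖NormedSpace.exp (s • (κ • L)) * Q‖ ≤ κ⁻¹ * I := by
  have h := intervalIntegral.integral_comp_mul_right (a := 0) (b := t)
    (fun s : ℝ => ‖NormedSpace.exp (s • L) * Q‖) hκ.ne'
  simp only [smul_smul]
  rw [h, zero_mul, smul_eq_mul]
  exact mul_le_mul_of_nonneg_left (hI _ (by positivity)) (by positivity)

variable [CompleteSpace 𝔸]

theorem hasDerivAt_exp_smul (A : 𝔸) (t : ℝ) :
    HasDerivAt (fun s : ℝ => NormedSpace.exp (s • A)) (NormedSpace.exp (t • A) * A) t :=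
  hasDerivAt_exp_smul_const A t

theorem continuous_exp_smul (A : 𝔸) : Continuous fun s : ℝ => NormedSpace.exp (s • A) :=
  continuous_iff_continuousAt.2 fun t => (hasDerivAt_exp_smul A t).continuousAt

theorem continuous_exp_sub_smul (A : 𝔸) (t : ℝ) :
    Continuous fun s : ℝ => NormedSpace.exp ((t - s) • A) :=
  (continuous_exp_smul A).comp (by fun_prop)

theorem continuous_duhamel_integrand (A B Y : 𝔸) (t : ℝ) :
    Continuous fun s : ℝ => NormedSpace.exp ((t - s) • A) * Y * NormedSpace.exp (s • B) :=
  ((continuous_exp_sub_smul A t).mul continuous_const).mul (continuous_exp_smul B)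

/-- Duhamel's formula for an intertwiner `X`. -/
theorem duhamel (A B X : 𝔸) (t : ℝ) :
    ∫ s in (0 : ℝ)..t, NormedSpace.exp ((t - s) • A) * (X * B - A * X) * NormedSpace.exp (s • B)
      = X * NormedSpace.exp (t • B) - NormedSpace.exp (t • A) * X := by
  have hder : ∀ s : ℝ, HasDerivAt
      (fun s : ℝ => NormedSpace.exp ((t - s) • A) * X * NormedSpace.exp (s • B))
      (NormedSpace.exp ((t - s) • A) * (X * B - A * X) * NormedSpace.exp (s • B)) s := by
    intro s
    have h1 : HasDerivAt (fun s : ℝ => NormedSpace.exp ((t - s) • A))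
        (-(NormedSpace.exp ((t - s) • A) * A)) s := by
      have := (hasDerivAt_exp_smul A (t - s)).scomp s ((hasDerivAt_id s).const_sub t)
      simpa [Function.comp_def] using this
    have h2 : HasDerivAt (fun s : ℝ => NormedSpace.exp (s • B)) (B * NormedSpace.exp (s • B)) s :=
      hasDerivAt_exp_smul_const' B s
    refine HasDerivAt.congr_deriv ((h1.mul_const X).mul h2) ?_
    simp only [mul_sub, sub_mul, neg_mul, mul_assoc]
    abel
  rw [intervalIntegral.integral_eq_sub_of_hasDerivAt (fun s _ => hder s)
    ((continuous_duhamel_integrand A B _ t).intervalIntegrable _ _)]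
  simp

/-- A bounded perturbation of a contraction semigroup grows at most like `exp (t ‖D‖)`. -/
theorem norm_exp_add_le {L : 𝔸} (hL : ∀ t : ℝ, 0 ≤ t → ‖NormedSpace.exp (t • L)‖ ≤ 1) (D : 𝔸)
    {t : ℝ} (ht : 0 ≤ t) : ‖NormedSpace.exp (t • (L + D))‖ ≤ Real.exp (t * ‖D‖) := by
  set g : ℝ → ℝ := fun s => ‖NormedSpace.exp (s • (L + D))‖ with hg
  have hgc : Continuous g := (continuous_exp_smul _).norm
  set G : ℝ → ℝ := fun s => 1 + ‖D‖ * ∫ u in (0 : ℝ)..s, g u with hG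
  have hgG : ∀ s, 0 ≤ s → g s ≤ G s := by
    intro s hs
    have h := duhamel L (L + D) 1 s
    have h' : NormedSpace.exp (s • (L + D)) = NormedSpace.exp (s • L) +
        ∫ u in (0 : ℝ)..s, NormedSpace.exp ((s - u) • L) * D * NormedSpace.exp (u • (L + D)) := by
      simp only [one_mul, mul_one, add_sub_cancel_left] at h
      rw [h]; abel
    simp only [hg, hG]
    rw [h', ← intervalIntegral.integral_const_mul]
    refine (norm_add_le _ _).trans (add_le_add (hL s hs) ?_)
    refine intervalIntegral.norm_integral_le_of_norm_le hs ?_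
      ((hgc.const_mul ‖D‖).intervalIntegrable 0 s)
    refine Filter.Eventually.of_forall fun u hu => ?_
    refine (norm_mul_le _ _).trans (mul_le_mul_of_nonneg_right ?_ (norm_nonneg _))
    calc _ ≤ ‖NormedSpace.exp ((s - u) • L)‖ * ‖D‖ := norm_mul_le _ _
      _ ≤ 1 * ‖D‖ := by
        gcongr
        exact hL _ (by linarith [hu.2])
      _ = ‖D‖ := one_mul _
  have hGd : ∀ s, HasDerivAt G (‖D‖ * g s) s := fun s =>
    ((intervalIntegral.integral_hasDerivAt_right (hgc.intervalIntegrable _ _)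
      hgc.aestronglyMeasurable.stronglyMeasurableAtFilter hgc.continuousAt).const_mul _).const_add _
  have hH : ∀ s, HasDerivAt (fun s => Real.exp (-(s * ‖D‖)) * G s)
      (Real.exp (-(s * ‖D‖)) * (‖D‖ * (g s - G s))) s := by
    intro s
    have h1 : HasDerivAt (fun s : ℝ => Real.exp (-(s * ‖D‖)))
        (Real.exp (-(s * ‖D‖)) * (-(1 * ‖D‖))) s :=
      (((hasDerivAt_id s).mul_const ‖D‖).neg).exp
    refine HasDerivAt.congr_deriv (h1.mul (hGd s)) ?_
    ring
  have hanti : AntitoneOn (fun s => Real.exp (-(s * ‖D‖)) * G s) (Set.Ici 0) := by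
    refine antitoneOn_of_deriv_nonpos (convex_Ici 0)
      (fun s _ => (hH s).continuousAt.continuousWithinAt)
      (fun s _ => (hH s).differentiableAt.differentiableWithinAt) fun s hs => ?_
    rw [interior_Ici] at hs
    rw [(hH s).deriv]
    have := hgG s (le_of_lt hs)
    exact mul_nonpos_of_nonneg_of_nonpos (Real.exp_pos _).le
      (mul_nonpos_of_nonneg_of_nonpos (norm_nonneg _) (by linarith))
  have h0 := hanti (Set.mem_Ici.2 le_rfl) (Set.mem_Ici.2 ht) ht
  simp only [hG, zero_mul, neg_zero, Real.exp_zero, intervalIntegral.integral_same, mul_zero,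
    add_zero, mul_one] at h0
  refine (hgG t ht).trans ?_
  rw [Real.exp_neg, inv_mul_le_iff₀ (Real.exp_pos _)] at h0
  simpa using h0

theorem norm_exp_smul_add_le {L : 𝔸} (hL : ∀ t : ℝ, 0 ≤ t → ‖NormedSpace.exp (t • L)‖ ≤ 1)
    {κ : ℝ} (hκ : 0 ≤ κ) (D : 𝔸) {t : ℝ} (ht : 0 ≤ t) :
    ‖NormedSpace.exp (t • (κ • L + D))‖ ≤ Real.exp (t * ‖D‖) :=
  norm_exp_add_le (fun s hs => by rw [smul_smul]; exact hL _ (mul_nonneg hs hκ)) D ht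

theorem exp_le_one_add (x : ℝ) : Real.exp x ≤ 1 + x * Real.exp x := by
  have h := Real.add_one_le_exp (-x)
  have h2 : Real.exp (-x) * Real.exp x = 1 := by rw [← Real.exp_add]; simp
  nlinarith [Real.exp_pos x]

theorem intertwine_exp {A B X : 𝔸} (h : X * B = A * X) (t : ℝ) :
    X * NormedSpace.exp (t • B) = NormedSpace.exp (t • A) * X := by
  have := duhamel A B X t
  simp only [h, sub_self, mul_zero, zero_mul, intervalIntegral.integral_zero] at this
  exact (sub_eq_zero.1 this.symm)

section Comparison

variable {L D Z P X : 𝔸} {κ I M t : ℝ}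

/-- The contribution of the oscillating part `[L, X]` of the perturbation. -/
theorem norm_integral_commutator_le (hL : ∀ t : ℝ, 0 ≤ t → ‖NormedSpace.exp (t • L)‖ ≤ 1)
    (hX : ‖X‖ ≤ M) (hκ : 0 < κ) (ht : 0 ≤ t) :
    ‖∫ s in (0 : ℝ)..t, NormedSpace.exp ((t - s) • (κ • L + D)) * (L * X - X * L) *
        NormedSpace.exp (s • (κ • L + Z))‖ ≤
      2 / κ * M * (Real.exp (t * ‖Z‖) * (1 + t * Real.exp (t * ‖D‖) * (‖D‖ + ‖Z‖))) := by
  set A := κ • L + D with hA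
  set B := κ • L + Z with hB
  have hM : 0 ≤ M := (norm_nonneg _).trans hX
  have hAn : ∀ s, 0 ≤ s → ‖NormedSpace.exp (s • A)‖ ≤ Real.exp (s * ‖D‖) :=
    fun s hs => norm_exp_smul_add_le hL hκ.le D hs
  have hBn : ∀ s, 0 ≤ s → ‖NormedSpace.exp (s • B)‖ ≤ Real.exp (s * ‖Z‖) :=
    fun s hs => norm_exp_smul_add_le hL hκ.le Z hs
  have hcomm : L * X - X * L = κ⁻¹ • ((X * Z - D * X) - (X * B - A * X)) := by
    have : (X * Z - D * X) - (X * B - A * X) = κ • (L * X - X * L) := by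
      simp only [hA, hB, mul_add, add_mul, mul_smul_comm, smul_mul_assoc, smul_sub]
      abel
    rw [this, smul_smul, inv_mul_cancel₀ hκ.ne', one_smul]
  have hint : ∫ s in (0 : ℝ)..t, NormedSpace.exp ((t - s) • A) * (L * X - X * L) *
        NormedSpace.exp (s • B) =
      κ⁻¹ • ((∫ s in (0 : ℝ)..t, NormedSpace.exp ((t - s) • A) * (X * Z - D * X) *
        NormedSpace.exp (s • B)) -
        (X * NormedSpace.exp (t • B) - NormedSpace.exp (t • A) * X)) := by
    rw [← duhamel A B X t, ← intervalIntegral.integral_sub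
      ((continuous_duhamel_integrand A B _ t).intervalIntegrable _ _)
      ((continuous_duhamel_integrand A B _ t).intervalIntegrable _ _),
      ← intervalIntegral.integral_smul]
    refine intervalIntegral.integral_congr fun s _ => ?_
    simp only [hcomm, mul_smul_comm, smul_mul_assoc, mul_sub, sub_mul]
  have h1 : ‖∫ s in (0 : ℝ)..t, NormedSpace.exp ((t - s) • A) * (X * Z - D * X) *
      NormedSpace.exp (s • B)‖ ≤
      (Real.exp (t * ‖D‖) * (M * (‖D‖ + ‖Z‖)) * Real.exp (t * ‖Z‖)) * |t - 0| := by
    refine intervalIntegral.norm_integral_le_of_norm_le_const fun s hs => ?_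
    rw [Set.uIoc_of_le ht] at hs
    have e1 := (hAn (t - s) (by linarith [hs.2])).trans
      (Real.exp_le_exp.2 (mul_le_mul_of_nonneg_right (by linarith [hs.1]) (norm_nonneg D)))
    have e2 := (hBn s hs.1.le).trans
      (Real.exp_le_exp.2 (mul_le_mul_of_nonneg_right hs.2 (norm_nonneg Z)))
    have e3 : ‖X * Z - D * X‖ ≤ M * (‖D‖ + ‖Z‖) := by
      refine (norm_sub_le _ _).trans ((add_le_add (norm_mul_le _ _) (norm_mul_le _ _)).trans ?_)
      nlinarith [mul_le_mul_of_nonneg_right hX (norm_nonneg Z),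
        mul_le_mul_of_nonneg_left hX (norm_nonneg D)]
    refine (norm_mul_le _ _).trans (mul_le_mul ((norm_mul_le _ _).trans ?_) e2 (norm_nonneg _)
      (by positivity))
    exact mul_le_mul e1 e3 (norm_nonneg _) (by positivity)
  have h2 : ‖X * NormedSpace.exp (t • B) - NormedSpace.exp (t • A) * X‖ ≤
      M * (Real.exp (t * ‖Z‖) + Real.exp (t * ‖D‖)) := by
    refine (norm_sub_le _ _).trans ((add_le_add (norm_mul_le _ _) (norm_mul_le _ _)).trans ?_)
    rw [mul_add, mul_comm M (Real.exp (t * ‖D‖))]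
    gcongr
    · exact hBn t ht
    · exact hAn t ht
  rw [hint, norm_smul, norm_inv, Real.norm_of_nonneg hκ.le]
  have h3 := (norm_sub_le _ _).trans (add_le_add h1 h2)
  rw [sub_zero, abs_of_nonneg ht] at h3
  refine (mul_le_mul_of_nonneg_left h3 (by positivity)).trans ?_
  have ez : 1 ≤ Real.exp (t * ‖Z‖) := Real.one_le_exp (by positivity)
  have ed := exp_le_one_add (t * ‖D‖)
  have e4 : Real.exp (t * ‖D‖) ≤ Real.exp (t * ‖Z‖) * (1 + t * ‖D‖ * Real.exp (t * ‖D‖)) :=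
    ed.trans (le_mul_of_one_le_left (by positivity) ez)
  have key : Real.exp (t * ‖D‖) * (M * (‖D‖ + ‖Z‖)) * Real.exp (t * ‖Z‖) * t +
      M * (Real.exp (t * ‖Z‖) + Real.exp (t * ‖D‖)) ≤
      2 * M * (Real.exp (t * ‖Z‖) * (1 + t * Real.exp (t * ‖D‖) * (‖D‖ + ‖Z‖))) := by
    have e5 := mul_le_mul_of_nonneg_left e4 hM
    have e6 : 0 ≤ M * (Real.exp (t * ‖Z‖) * (t * Real.exp (t * ‖D‖) * ‖Z‖)) := by positivity
    nlinarith
  calc _ ≤ κ⁻¹ * (2 * M * (Real.exp (t * ‖Z‖) *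
        (1 + t * Real.exp (t * ‖D‖) * (‖D‖ + ‖Z‖)))) :=
        mul_le_mul_of_nonneg_left key (by positivity)
    _ = _ := by rw [div_eq_mul_inv]; ring

/-- The perturbed semigroup restricted to the decaying part of `L`. -/
theorem norm_exp_mul_le_of_decay {Q : 𝔸} {r : ℝ}
    (hL : ∀ t : ℝ, 0 ≤ t → ‖NormedSpace.exp (t • L)‖ ≤ 1)
    (hI : ∀ T : ℝ, 0 ≤ T → ∫ s in (0 : ℝ)..T, ‖NormedSpace.exp (s • L) * Q‖ ≤ I)
    (hκ : 0 < κ) (hr : 0 ≤ r) :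
    ‖NormedSpace.exp (r • (κ • L + D)) * Q‖ ≤ ‖NormedSpace.exp (r • (κ • L)) * Q‖ +
      Real.exp (r * ‖D‖) * ‖D‖ * (κ⁻¹ * I) := by
  have h := duhamel (κ • L + D) (κ • L) 1 r
  have hc : Continuous fun u : ℝ => ‖NormedSpace.exp (u • (κ • L)) * Q‖ :=
    ((continuous_exp_smul _).mul continuous_const).norm
  have h' : NormedSpace.exp (r • (κ • L + D)) * Q = NormedSpace.exp (r • (κ • L)) * Q +
      ∫ u in (0 : ℝ)..r, NormedSpace.exp ((r - u) • (κ • L + D)) * D *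
        NormedSpace.exp (u • (κ • L)) * Q := by
    have hm : ∫ u in (0 : ℝ)..r, NormedSpace.exp ((r - u) • (κ • L + D)) * D *
        NormedSpace.exp (u • (κ • L)) * Q = (∫ u in (0 : ℝ)..r,
          NormedSpace.exp ((r - u) • (κ • L + D)) * D * NormedSpace.exp (u • (κ • L))) * Q :=
      ((ContinuousLinearMap.mul ℝ 𝔸).flip Q).intervalIntegral_comp_comm
        ((continuous_duhamel_integrand _ _ D r).intervalIntegrable _ _)
    rw [hm]
    have e : (1 : 𝔸) * κ • L - (κ • L + D) * 1 = -D := by simp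
    rw [e] at h
    simp only [mul_neg, neg_mul, intervalIntegral.integral_neg, one_mul, mul_one] at h
    rw [← add_mul, ← neg_neg (∫ u in (0 : ℝ)..r, _), h]
    congr 1
    abel
  rw [h']
  refine (norm_add_le _ _).trans (add_le_add le_rfl ?_)
  calc _ ≤ ∫ u in (0 : ℝ)..r, Real.exp (r * ‖D‖) * ‖D‖ * ‖NormedSpace.exp (u • (κ • L)) * Q‖ := by
        refine intervalIntegral.norm_integral_le_of_norm_le hr ?_
          ((hc.const_mul _).intervalIntegrable _ _)
        refine Filter.Eventually.of_forall fun u hu => ?_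
        rw [mul_assoc]
        refine (norm_mul_le _ _).trans (mul_le_mul_of_nonneg_right ?_ (norm_nonneg _))
        refine (norm_mul_le _ _).trans (mul_le_mul_of_nonneg_right ?_ (norm_nonneg _))
        exact (norm_exp_smul_add_le hL hκ.le D (by linarith [hu.2])).trans
          (Real.exp_le_exp.2 (mul_le_mul_of_nonneg_right (by linarith [hu.1]) (norm_nonneg D)))
    _ = Real.exp (r * ‖D‖) * ‖D‖ * ∫ u in (0 : ℝ)..r, ‖NormedSpace.exp (u • (κ • L)) * Q‖ :=
        intervalIntegral.integral_const_mul _ _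
    _ ≤ _ := by
        gcongr
        exact integral_norm_exp_scaled_le hI hκ hr

/-- The contribution of the part of the perturbation that maps into the decaying part. -/
theorem norm_integral_into_decaying_le {Q : 𝔸}
    (hL : ∀ t : ℝ, 0 ≤ t → ‖NormedSpace.exp (t • L)‖ ≤ 1) (hP : ‖P‖ ≤ 1)
    (hI : ∀ T : ℝ, 0 ≤ T → ∫ s in (0 : ℝ)..T, ‖NormedSpace.exp (s • L) * Q‖ ≤ I)
    (hκ : 0 < κ) (ht : 0 ≤ t) :
    ‖∫ s in (0 : ℝ)..t, NormedSpace.exp ((t - s) • (κ • L + D)) * (Q * D * P) *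
        NormedSpace.exp (s • (κ • L + Z))‖ ≤
      κ⁻¹ * I * ‖D‖ * (Real.exp (t * ‖Z‖) * (1 + t * Real.exp (t * ‖D‖) * ‖D‖)) := by
  have hI0 : 0 ≤ I := by simpa using hI 0 le_rfl
  set c := Real.exp (t * ‖D‖) * ‖D‖ * (κ⁻¹ * I) with hc
  have hcont : Continuous fun u : ℝ => ‖NormedSpace.exp (u • (κ • L)) * Q‖ :=
    ((continuous_exp_smul _).mul continuous_const).norm
  calc _ ≤ ∫ s in (0 : ℝ)..t, (‖NormedSpace.exp ((t - s) • (κ • L)) * Q‖ + c) *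
        (‖D‖ * Real.exp (t * ‖Z‖)) := by
        refine intervalIntegral.norm_integral_le_of_norm_le ht ?_
          ((((hcont.comp (continuous_const.sub continuous_id)).add_const c).mul_const
            _).intervalIntegrable _ _)
        refine Filter.Eventually.of_forall fun s hs => ?_
        have hs0 : 0 ≤ t - s := by linarith [hs.2]
        have e1 : ‖NormedSpace.exp ((t - s) • (κ • L + D)) * Q‖ ≤
            ‖NormedSpace.exp ((t - s) • (κ • L)) * Q‖ + c := by
          refine (norm_exp_mul_le_of_decay hL hI hκ hs0).trans (add_le_add le_rfl ?_)
          rw [hc]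
          gcongr
          linarith [hs.1]
        have e2 : ‖NormedSpace.exp (s • (κ • L + Z))‖ ≤ Real.exp (t * ‖Z‖) :=
          (norm_exp_smul_add_le hL hκ.le Z hs.1.le).trans
            (Real.exp_le_exp.2 (mul_le_mul_of_nonneg_right hs.2 (norm_nonneg Z)))
        have e3 : ‖D * P * NormedSpace.exp (s • (κ • L + Z))‖ ≤ ‖D‖ * Real.exp (t * ‖Z‖) := by
          refine (norm_mul_le _ _).trans (mul_le_mul ((norm_mul_le _ _).trans ?_) e2
            (norm_nonneg _) (norm_nonneg _))
          exact mul_le_of_le_one_right (norm_nonneg _) hP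
        have e4 : NormedSpace.exp ((t - s) • (κ • L + D)) * (Q * D * P) *
            NormedSpace.exp (s • (κ • L + Z)) = NormedSpace.exp ((t - s) • (κ • L + D)) * Q *
              (D * P * NormedSpace.exp (s • (κ • L + Z))) := by noncomm_ring
        rw [e4]
        exact (norm_mul_le _ _).trans (mul_le_mul e1 e3 (norm_nonneg _)
          ((norm_nonneg _).trans e1))
    _ = ((∫ s in (0 : ℝ)..t, ‖NormedSpace.exp (s • (κ • L)) * Q‖) + t * c) *
        (‖D‖ * Real.exp (t * ‖Z‖)) := by
        have hi : IntervalIntegrable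
            (fun s : ℝ => ‖NormedSpace.exp ((t - s) • (κ • L)) * Q‖) volume 0 t :=
          (hcont.comp (continuous_const.sub continuous_id)).intervalIntegrable _ _
        rw [intervalIntegral.integral_mul_const, intervalIntegral.integral_add hi
          (continuous_const.intervalIntegrable _ _), intervalIntegral.integral_const,
          intervalIntegral.integral_comp_sub_left
            (fun s : ℝ => ‖NormedSpace.exp (s • (κ • L)) * Q‖) t]
        simp
    _ ≤ (κ⁻¹ * I + t * c) * (‖D‖ * Real.exp (t * ‖Z‖)) := by
        gcongr
        exact integral_norm_exp_scaled_le hI hκ ht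
    _ = _ := by rw [hc]; ring

/-- The contribution of the part of the perturbation that acts on the decaying part. -/
theorem norm_integral_from_decaying_le {Q : 𝔸}
    (hL : ∀ t : ℝ, 0 ≤ t → ‖NormedSpace.exp (t • L)‖ ≤ 1)
    (hQL : Q * L = L * Q) (hQZ : Q * Z = 0)
    (hI : ∀ T : ℝ, 0 ≤ T → ∫ s in (0 : ℝ)..T, ‖NormedSpace.exp (s • L) * Q‖ ≤ I)
    (hκ : 0 < κ) (ht : 0 ≤ t) :
    ‖∫ s in (0 : ℝ)..t, NormedSpace.exp ((t - s) • (κ • L + D)) * (D * Q) *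
        NormedSpace.exp (s • (κ • L + Z))‖ ≤
      κ⁻¹ * I * ‖D‖ * Real.exp (t * ‖D‖) := by
  have hcont : Continuous fun u : ℝ => ‖NormedSpace.exp (u • (κ • L)) * Q‖ :=
    ((continuous_exp_smul _).mul continuous_const).norm
  have hQ : ∀ s : ℝ, Q * NormedSpace.exp (s • (κ • L + Z)) = NormedSpace.exp (s • (κ • L)) * Q :=
    fun s => intertwine_exp (by
      rw [mul_add, hQZ, add_zero, mul_smul_comm, smul_mul_assoc, hQL]) s
  calc _ ≤ ∫ s in (0 : ℝ)..t, Real.exp (t * ‖D‖) * ‖D‖ * ‖NormedSpace.exp (s • (κ • L)) * Q‖ := by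
        refine intervalIntegral.norm_integral_le_of_norm_le ht ?_
          ((hcont.const_mul _).intervalIntegrable _ _)
        refine Filter.Eventually.of_forall fun s hs => ?_
        rw [← mul_assoc, mul_assoc, hQ]
        refine (norm_mul_le _ _).trans (mul_le_mul_of_nonneg_right ?_ (norm_nonneg _))
        refine (norm_mul_le _ _).trans (mul_le_mul_of_nonneg_right ?_ (norm_nonneg _))
        exact (norm_exp_smul_add_le hL hκ.le D (by linarith [hs.2])).trans
          (Real.exp_le_exp.2 (mul_le_mul_of_nonneg_right (by linarith [hs.1]) (norm_nonneg D)))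
    _ = Real.exp (t * ‖D‖) * ‖D‖ * ∫ s in (0 : ℝ)..t, ‖NormedSpace.exp (s • (κ • L)) * Q‖ :=
        intervalIntegral.integral_const_mul _ _
    _ ≤ Real.exp (t * ‖D‖) * ‖D‖ * (κ⁻¹ * I) := by
        gcongr
        exact integral_norm_exp_scaled_le hI hκ ht
    _ = _ := by ring

/-- Comparison of the semigroups generated by `κ L + D` and `κ L + Z`, when `P D P - Z` is a
commutator `[L, X]` and `exp (t L)` decays on the complement of `P`. -/
theorem norm_exp_sub_exp_le (hL : ∀ t : ℝ, 0 ≤ t → ‖NormedSpace.exp (t • L)‖ ≤ 1)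
    (hP : ‖P‖ ≤ 1) (hPL : P * L = L * P) (hPZ : P * Z = Z)
    (hcomm : L * X - X * L = P * D * P - Z) (hX : ‖X‖ ≤ M * ‖D‖)
    (hI : ∀ T : ℝ, 0 ≤ T → ∫ s in (0 : ℝ)..T, ‖NormedSpace.exp (s • L) * (1 - P)‖ ≤ I)
    (hκ : 0 < κ) (ht : 0 ≤ t) :
    ‖NormedSpace.exp (t • (κ • L + D)) - NormedSpace.exp (t • (κ • L + Z))‖ ≤
      2 / κ * (M + I) * ‖D‖ * Real.exp (t * ‖Z‖) *
        (1 + t * Real.exp (t * ‖D‖) * (‖D‖ + ‖Z‖)) := by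
  have hI0 : 0 ≤ I := by simpa using hI 0 le_rfl
  set A := κ • L + D with hA
  set B := κ • L + Z with hB
  have hdec : NormedSpace.exp (t • A) - NormedSpace.exp (t • B) =
      (∫ s in (0 : ℝ)..t, NormedSpace.exp ((t - s) • A) * (L * X - X * L) *
        NormedSpace.exp (s • B)) +
      (∫ s in (0 : ℝ)..t, NormedSpace.exp ((t - s) • A) * ((1 - P) * D * P) *
        NormedSpace.exp (s • B)) +
      (∫ s in (0 : ℝ)..t, NormedSpace.exp ((t - s) • A) * (D * (1 - P)) *
        NormedSpace.exp (s • B)) := by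
    have h := duhamel A B 1 t
    have e : (1 : 𝔸) * B - A * 1 =
        -((L * X - X * L) + (1 - P) * D * P + D * (1 - P)) := by
      rw [hcomm, hA, hB]; noncomm_ring
    have hi : ∀ Y : 𝔸, IntervalIntegrable (fun s => NormedSpace.exp ((t - s) • A) * Y *
        NormedSpace.exp (s • B)) volume 0 t :=
      fun Y => (continuous_duhamel_integrand A B Y t).intervalIntegrable _ _
    rw [← intervalIntegral.integral_add (hi _) (hi _),
      ← intervalIntegral.integral_add ((hi _).add (hi _)) (hi _)]
    rw [e, one_mul, mul_one] at h
    rw [← neg_sub, ← h, ← intervalIntegral.integral_neg]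
    refine intervalIntegral.integral_congr fun s _ => ?_
    simp only [mul_neg, neg_mul, neg_neg, mul_add, add_mul]
  have b1 := norm_integral_commutator_le (D := D) (Z := Z) hL hX hκ ht
  have b2 := norm_integral_into_decaying_le (D := D) (Z := Z) hL hP hI hκ ht
  have b3 := norm_integral_from_decaying_le (D := D) hL
    (by rw [sub_mul, mul_sub, hPL, one_mul, mul_one])
    (by rw [sub_mul, one_mul, hPZ, sub_self]) hI hκ ht
  rw [hdec]
  refine ((norm_add₃_le).trans (add_le_add (add_le_add b1 b2) b3)).trans ?_
  have ez : 1 ≤ Real.exp (t * ‖Z‖) := Real.one_le_exp (by positivity)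
  have ed : Real.exp (t * ‖D‖) ≤ Real.exp (t * ‖Z‖) * (1 + t * Real.exp (t * ‖D‖) * ‖D‖) := by
    have := exp_le_one_add (t * ‖D‖)
    refine le_trans ?_ (le_mul_of_one_le_left (by positivity) ez)
    linarith
  have e1 : Real.exp (t * ‖Z‖) * (1 + t * Real.exp (t * ‖D‖) * ‖D‖) ≤
      Real.exp (t * ‖Z‖) * (1 + t * Real.exp (t * ‖D‖) * (‖D‖ + ‖Z‖)) := by
    gcongr
    linarith [norm_nonneg Z]
  have h0 : 0 ≤ κ⁻¹ * I * ‖D‖ := by positivity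
  have f1 := mul_le_mul_of_nonneg_left e1 h0
  have f2 := mul_le_mul_of_nonneg_left (ed.trans e1) h0
  refine (add_le_add (add_le_add le_rfl f1) f2).trans (le_of_eq ?_)
  rw [div_eq_mul_inv]
  ring

end Comparison

end Semigroup

section Nilpotent

open scoped Nat

variable {𝔸 : Type*} [NormedRing 𝔸] [NormedAlgebra ℂ 𝔸] [CompleteSpace 𝔸]

theorem exp_smul_mul_of_pow_mul_eq_zero {N M : 𝔸} {k : ℕ} (h : N ^ k * M = 0) (c : ℂ) :
    NormedSpace.exp (c • N) * M =
      ∑ j ∈ Finset.range k, (((j ! : ℂ)⁻¹ * c ^ j) • (N ^ j * M)) := by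
  have hs := NormedSpace.expSeries_summable' (𝕂 := ℂ) (c • N)
  rw [NormedSpace.exp_eq_tsum ℂ]
  simp only
  rw [← hs.tsum_mul_right, tsum_eq_sum (s := Finset.range k)]
  · refine Finset.sum_congr rfl fun j _ => ?_
    rw [smul_pow, smul_smul, smul_mul_assoc]
  · intro j hj
    rw [Finset.mem_range, not_lt] at hj
    obtain ⟨i, rfl⟩ := Nat.exists_eq_add_of_le hj
    rw [smul_pow, smul_smul, smul_mul_assoc, add_comm k i, pow_add N, mul_assoc, h, mul_zero,
      smul_zero]

theorem exp_smul_eq_exp_smul_exp_sub (L : 𝔸) (α c : ℂ) :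
    NormedSpace.exp (c • L) =
      Complex.exp (c * α) • NormedSpace.exp (c • (L - algebraMap ℂ 𝔸 α)) := by
  set N := c • (L - algebraMap ℂ 𝔸 α) with hN
  have h1 : c • L = algebraMap ℂ 𝔸 (c * α) + N := by
    rw [hN, Algebra.algebraMap_eq_smul_one, Algebra.algebraMap_eq_smul_one, smul_sub, smul_smul]
    abel
  let _ : NormedAlgebra ℚ 𝔸 := NormedAlgebra.restrictScalars ℚ ℂ 𝔸
  rw [h1, NormedSpace.exp_add_of_commute (Algebra.commutes _ _), ← NormedSpace.algebraMap_exp_comm,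
    ← Complex.exp_eq_exp_ℂ, Algebra.smul_def]

theorem exp_smul_mul_of_generalized {L M : 𝔸} {α : ℂ} {k : ℕ}
    (h : (L - algebraMap ℂ 𝔸 α) ^ k * M = 0) (c : ℂ) :
    NormedSpace.exp (c • L) * M = Complex.exp (c * α) •
      ∑ j ∈ Finset.range k, (((j ! : ℂ)⁻¹ * c ^ j) • ((L - algebraMap ℂ 𝔸 α) ^ j * M)) := by
  rw [exp_smul_eq_exp_smul_exp_sub L α, smul_mul_assoc, exp_smul_mul_of_pow_mul_eq_zero h]

theorem exp_smul_mul_of_eigen {L M : 𝔸} {α : ℂ} (h : (L - algebraMap ℂ 𝔸 α) * M = 0) (c : ℂ) :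
    NormedSpace.exp (c • L) * M = Complex.exp (c * α) • M := by
  rw [exp_smul_mul_of_generalized (k := 1) (by rwa [pow_one])]
  simp

/-- The nilpotent part of the generator of a contraction semigroup vanishes at the imaginary
axis. -/
theorem mul_eq_zero_of_pow_mul_eq_zero {L : 𝔸}
    (hL : ∀ t : ℝ, 0 ≤ t → ‖NormedSpace.exp ((t : ℂ) • L)‖ ≤ 1) {α : ℂ} (hα : α.re = 0)
    {M : 𝔸} {k : ℕ} (h : (L - algebraMap ℂ 𝔸 α) ^ k * M = 0) :
    (L - algebraMap ℂ 𝔸 α) * M = 0 := by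
  set N := L - algebraMap ℂ 𝔸 α with hN
  have key : ∀ M : 𝔸, N ^ 2 * M = 0 → N * M = 0 := by
    intro M hM
    have hb : ∀ t : ℝ, 0 ≤ t → t * ‖N * M‖ ≤ 2 * ‖M‖ := by
      intro t ht
      have e := exp_smul_mul_of_generalized hM (t : ℂ)
      have hn : ‖Complex.exp ((t : ℂ) * α)‖ = 1 := by
        rw [Complex.norm_exp]; simp [hα]
      have e2 : ‖M + (t : ℂ) • (N * M)‖ ≤ ‖M‖ := by
        have e3 := norm_mul_le (NormedSpace.exp ((t : ℂ) • L)) M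
        rw [e, norm_smul, hn, one_mul] at e3
        simp only [Finset.sum_range_succ, Finset.range_zero, Finset.sum_empty] at e3
        simp only [Nat.factorial, pow_zero, pow_one, one_mul, mul_one, Nat.cast_one, inv_one,
          one_smul, zero_add] at e3
        exact e3.trans (mul_le_of_le_one_left (norm_nonneg _) (hL t ht))
      have e4 : ‖(t : ℂ) • (N * M)‖ ≤ ‖M + (t : ℂ) • (N * M)‖ + ‖M‖ := by
        simpa using norm_sub_le (M + (t : ℂ) • (N * M)) M
      rw [norm_smul, Complex.norm_real, Real.norm_of_nonneg ht] at e4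
      linarith
    by_contra hne
    have hpos : 0 < ‖N * M‖ := norm_pos_iff.2 hne
    have := hb ((2 * ‖M‖ + 1) / ‖N * M‖) (by positivity)
    rw [div_mul_cancel₀ _ hpos.ne'] at this
    linarith
  induction k with
  | zero => rw [pow_zero, one_mul] at h; rw [h, mul_zero]
  | succ k ih =>
    cases k with
    | zero => simpa using h
    | succ k =>
      refine ih ?_
      rw [pow_succ', mul_assoc]
      refine key _ ?_
      rw [← mul_assoc, ← pow_add, add_comm 2 k]
      exact h

/-- Eigenvalues of the generator of a contraction semigroup lie in the closed left half-plane. -/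
theorem re_nonpos_of_pow_mul_eq_zero {L : 𝔸}
    (hL : ∀ t : ℝ, 0 ≤ t → ‖NormedSpace.exp ((t : ℂ) • L)‖ ≤ 1) {α : ℂ}
    {M : 𝔸} (hM : M ≠ 0) {k : ℕ} (h : (L - algebraMap ℂ 𝔸 α) ^ k * M = 0) : α.re ≤ 0 := by
  induction k generalizing M with
  | zero => rw [pow_zero, one_mul] at h; exact absurd h hM
  | succ k ih =>
    by_cases h1 : (L - algebraMap ℂ 𝔸 α) * M = 0
    · have h2 := norm_mul_le (NormedSpace.exp (((1 : ℝ) : ℂ) • L)) M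
      rw [exp_smul_mul_of_eigen h1, norm_smul, Complex.norm_exp] at h2
      have h3 := h2.trans (mul_le_of_le_one_left (norm_nonneg M) (hL 1 zero_le_one))
      have h4 : Real.exp α.re ≤ 1 := by
        simpa using (mul_le_iff_le_one_left (norm_pos_iff.2 hM)).1 h3
      simpa using h4
    · refine ih h1 ?_
      rwa [← mul_assoc, ← pow_succ]

theorem continuous_norm_exp_smul_mul (L M : 𝔸) :
    Continuous fun s : ℝ => ‖NormedSpace.exp ((s : ℂ) • L) * M‖ := by
  let _ : NormedAlgebra ℚ 𝔸 := NormedAlgebra.restrictScalars ℚ ℂ 𝔸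
  exact (((NormedSpace.exp_continuous).comp (by fun_prop)).mul continuous_const).norm

theorem integrableOn_norm_exp_smul_mul {L M : 𝔸} {α : ℂ} (hα : α.re < 0) {k : ℕ}
    (h : (L - algebraMap ℂ 𝔸 α) ^ k * M = 0) :
    IntegrableOn (fun s : ℝ => ‖NormedSpace.exp ((s : ℂ) • L) * M‖) (Set.Ioi 0) := by
  have hg : IntegrableOn (fun s : ℝ => ∑ j ∈ Finset.range k,
      (s ^ (j : ℝ) * Real.exp (-(-α.re) * s ^ (1 : ℝ))) *
        ‖((j ! : ℂ)⁻¹) • ((L - algebraMap ℂ 𝔸 α) ^ j * M)‖) (Set.Ioi 0) := by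
    refine integrable_finsetSum _ fun j _ => Integrable.mul_const ?_ _
    exact integrableOn_rpow_mul_exp_neg_mul_rpow
      (by have : (0 : ℝ) ≤ j := Nat.cast_nonneg j
          linarith) zero_lt_one (by linarith)
  refine Integrable.mono' hg (continuous_norm_exp_smul_mul L M).aestronglyMeasurable ?_
  refine (ae_restrict_iff' measurableSet_Ioi).2 (Eventually.of_forall fun s hs => ?_)
  have hs0 : (0 : ℝ) < s := hs
  rw [norm_norm, exp_smul_mul_of_generalized h, norm_smul, Complex.norm_exp]
  refine (mul_le_mul_of_nonneg_left (norm_sum_le _ _) (Real.exp_pos _).le).trans (le_of_eq ?_)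
  rw [Finset.mul_sum]
  refine Finset.sum_congr rfl fun j _ => ?_
  rw [mul_comm ((j ! : ℂ)⁻¹), mul_smul, norm_smul, norm_pow, Complex.norm_real,
    Real.norm_of_nonneg hs0.le, Real.rpow_natCast, Real.rpow_one]
  have : ((s : ℂ) * α).re = -(-α.re) * s := by simp [mul_comm]
  rw [this]
  ring

theorem antitone_norm_exp_smul_mul {L : 𝔸}
    (hL : ∀ t : ℝ, 0 ≤ t → ‖NormedSpace.exp ((t : ℂ) • L)‖ ≤ 1) (M : 𝔸) {s t : ℝ} (hst : s ≤ t) :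
    ‖NormedSpace.exp ((t : ℂ) • L) * M‖ ≤ ‖NormedSpace.exp ((s : ℂ) • L) * M‖ := by
  let _ : NormedAlgebra ℚ 𝔸 := NormedAlgebra.restrictScalars ℚ ℂ 𝔸
  have : NormedSpace.exp ((t : ℂ) • L) =
      NormedSpace.exp (((t - s : ℝ) : ℂ) • L) * NormedSpace.exp ((s : ℂ) • L) := by
    rw [← NormedSpace.exp_add_of_commute
      (((Commute.refl L).smul_left _).smul_right _), ← add_smul]
    simp
  rw [this, mul_assoc]
  exact (norm_mul_le _ _).trans
    (mul_le_of_le_one_left (norm_nonneg _) (hL _ (sub_nonneg.2 hst)))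

theorem tendsto_exp_smul_mul_zero {L : 𝔸}
    (hL : ∀ t : ℝ, 0 ≤ t → ‖NormedSpace.exp ((t : ℂ) • L)‖ ≤ 1) {M : 𝔸} {I : ℝ}
    (hI : ∀ T : ℝ, 0 ≤ T → ∫ s in (0 : ℝ)..T, ‖NormedSpace.exp ((s : ℂ) • L) * M‖ ≤ I) :
    Tendsto (fun t : ℝ => NormedSpace.exp ((t : ℂ) • L) * M) atTop (𝓝 0) := by
  refine squeeze_zero_norm' (a := fun t : ℝ => I / t) ?_ (tendsto_const_nhds.div_atTop tendsto_id)
  filter_upwards [eventually_gt_atTop 0] with t ht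
  rw [le_div_iff₀ ht]
  refine le_trans ?_ (hI t ht.le)
  have := intervalIntegral.integral_mono_on (μ := volume) ht.le
    ((continuous_const (y := ‖NormedSpace.exp ((t : ℂ) • L) * M‖)).intervalIntegrable 0 t)
    ((continuous_norm_exp_smul_mul L M).intervalIntegrable 0 t)
    fun s hs => antitone_norm_exp_smul_mul hL M hs.2
  simpa [mul_comm] using this

end Nilpotent

/-- Simultaneous recurrence of finitely many rotations. -/
theorem exists_tendsto_exp_nat_mul (S : Finset ℂ) (hS : ∀ α ∈ S, α.re = 0) :
    ∃ ψ : ℕ → ℕ, Tendsto ψ atTop atTop ∧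
      ∀ α ∈ S, Tendsto (fun j => Complex.exp ((ψ j : ℂ) * α)) atTop (𝓝 1) := by
  obtain ⟨a, φ, hφ, ha⟩ := CompactSpace.tendsto_subseq
    fun (n : ℕ) (α : S) => Circle.exp (n * (α : ℂ).im)
  have hle : ∀ j, φ j + j ≤ φ (2 * j) := by
    intro j
    have := hφ.add_le_nat j j
    rwa [two_mul, add_comm (φ j)]
  refine ⟨fun j => φ (2 * j) - φ j, ?_, fun α hα => ?_⟩
  · refine tendsto_atTop_mono (fun j => ?_) tendsto_id
    have := hle j
    simp only [id]
    omega
  · have h1 := (tendsto_pi_nhds.1 ha) ⟨α, hα⟩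
    have h2 : Tendsto (fun j : ℕ => 2 * j) atTop atTop :=
      tendsto_atTop_mono (fun j => by simp only [id]; omega) tendsto_id
    have h3 := (h1.comp h2).div' h1
    rw [div_self'] at h3
    have h4 := ((continuous_subtype_val
      (p := fun z : ℂ => z ∈ Submonoid.unitSphere ℂ)).tendsto _).comp h3
    rw [Circle.coe_one] at h4
    refine h4.congr fun j => ?_
    have him : α = (α.im : ℂ) * Complex.I := by
      apply Complex.ext <;> simp [hS α hα]
    have hcast : ((φ (2 * j) - φ j : ℕ) : ℂ) = (φ (2 * j) : ℂ) - φ j :=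
      Nat.cast_sub (by have := hle j; omega)
    simp only [Function.comp]
    rw [← Circle.exp_sub, Circle.coe_exp, hcast]
    conv_rhs => rw [him]
    congr 1
    push_cast
    ring

section ComplexAlgebra

variable {𝔸 : Type*} [NormedRing 𝔸] [NormedAlgebra ℂ 𝔸] [CompleteSpace 𝔸]

/-- Comparison of semigroups with complex scalars. -/
theorem norm_exp_sub_exp_le_of_complex {L D Z P X : 𝔸} {κ I M t : ℝ}
    (hL : ∀ t : ℝ, 0 ≤ t → ‖NormedSpace.exp ((t : ℂ) • L)‖ ≤ 1)
    (hP : ‖P‖ ≤ 1) (hPL : P * L = L * P) (hPZ : P * Z = Z)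
    (hcomm : L * X - X * L = P * D * P - Z) (hX : ‖X‖ ≤ M * ‖D‖)
    (hI : ∀ T : ℝ, 0 ≤ T → ∫ s in (0 : ℝ)..T, ‖NormedSpace.exp ((s : ℂ) • L) * (1 - P)‖ ≤ I)
    (hκ : 0 < κ) (ht : 0 ≤ t) :
    ‖NormedSpace.exp ((t : ℂ) • ((κ : ℂ) • L + D)) -
        NormedSpace.exp ((t : ℂ) • ((κ : ℂ) • L + Z))‖ ≤
      2 / κ * (M + I) * ‖D‖ * Real.exp (t * ‖Z‖) *
        (1 + t * Real.exp (t * ‖D‖) * (‖D‖ + ‖Z‖)) := by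
  simp only [Complex.coe_smul] at hL hI ⊢
  exact norm_exp_sub_exp_le hL hP hPL hPZ hcomm hX hI hκ ht

theorem integral_conj_exp {L X Y Z : 𝔸} (hZ : Z * L = L * Z) (hcomm : L * X - X * L = Y - Z)
    (τ : ℝ) :
    ∫ s in (0 : ℝ)..τ, NormedSpace.exp (-((s : ℂ) • L)) * Y * NormedSpace.exp ((s : ℂ) • L) =
      (τ : ℂ) • Z + (X -
        NormedSpace.exp (-((τ : ℂ) • L)) * X * NormedSpace.exp ((τ : ℂ) • L)) := by
  simp only [Complex.coe_smul, ← smul_neg]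
  let _ : NormedAlgebra ℚ 𝔸 := NormedAlgebra.restrictScalars ℚ ℂ 𝔸
  have hZe : ∀ s : ℝ, NormedSpace.exp (s • -L) * Z * NormedSpace.exp (s • L) = Z := by
    intro s
    rw [mul_assoc, intertwine_exp hZ s, ← mul_assoc, smul_neg,
      ← NormedSpace.exp_add_of_commute (Commute.refl (s • L)).neg_left, neg_add_cancel,
      NormedSpace.exp_zero, one_mul]
  have hd : ∀ s : ℝ, HasDerivAt
      (fun s : ℝ => s • Z - NormedSpace.exp (s • -L) * X * NormedSpace.exp (s • L))
      (NormedSpace.exp (s • -L) * Y * NormedSpace.exp (s • L)) s := by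
    intro s
    have h1 := hasDerivAt_exp_smul (-L) s
    have h2 : HasDerivAt (fun s : ℝ => NormedSpace.exp (s • L)) (L * NormedSpace.exp (s • L)) s :=
      hasDerivAt_exp_smul_const' L s
    refine HasDerivAt.congr_deriv
      (((hasDerivAt_id s).smul_const Z).sub ((h1.mul_const X).mul h2)) ?_
    rw [eq_add_of_sub_eq hcomm.symm, one_smul]
    nth_rw 1 [← hZe s]
    simp only [mul_add, mul_sub, add_mul, sub_mul, mul_neg, neg_mul, mul_assoc]
    abel
  have hc : Continuous fun s : ℝ => NormedSpace.exp (s • -L) * Y * NormedSpace.exp (s • L) :=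
    ((continuous_exp_smul _).mul continuous_const).mul (continuous_exp_smul _)
  rw [intervalIntegral.integral_eq_sub_of_hasDerivAt (fun s _ => hd s)
    (hc.intervalIntegrable _ _)]
  simp only [zero_smul, NormedSpace.exp_zero, one_mul, mul_one]
  abel

/-- Ergodic average of a conjugation, when the fluctuation is a bounded commutator. -/
theorem tendsto_average_conj_exp {L X Y Z : 𝔸} {C : ℝ} (hZ : Z * L = L * Z)
    (hcomm : L * X - X * L = Y - Z)
    (hC : ∀ τ : ℝ, 0 ≤ τ →
      ‖NormedSpace.exp (-((τ : ℂ) • L)) * X * NormedSpace.exp ((τ : ℂ) • L)‖ ≤ C) :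
    Tendsto (fun τ : ℝ => ((τ⁻¹ : ℝ) : ℂ) • ∫ s in (0 : ℝ)..τ,
      NormedSpace.exp (-((s : ℂ) • L)) * Y * NormedSpace.exp ((s : ℂ) • L)) atTop (𝓝 Z) := by
  have h0 : Tendsto (fun τ : ℝ => ((τ⁻¹ : ℝ) : ℂ) • (X -
        NormedSpace.exp (-((τ : ℂ) • L)) * X * NormedSpace.exp ((τ : ℂ) • L))) atTop (𝓝 0) := by
    refine squeeze_zero_norm' (a := fun τ : ℝ => τ⁻¹ * (‖X‖ + C)) ?_
      (by simpa using tendsto_inv_atTop_zero.mul_const (‖X‖ + C))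
    filter_upwards [eventually_gt_atTop 0] with τ hτ
    rw [norm_smul, Complex.norm_real, Real.norm_of_nonneg (inv_nonneg.2 hτ.le)]
    gcongr
    exact (norm_sub_le _ _).trans (add_le_add le_rfl (hC τ hτ.le))
  have h1 := h0.const_add Z
  rw [add_zero] at h1
  refine h1.congr' ?_
  filter_upwards [eventually_gt_atTop 0] with τ hτ
  rw [integral_conj_exp hZ hcomm, smul_add, smul_smul, ← Complex.ofReal_mul,
    inv_mul_cancel₀ hτ.ne', Complex.ofReal_one, one_smul]

end ComplexAlgebra

theorem exists_pos_le_of_finset {ι : Type*} (F : Finset ι) (f : ι → ℝ) (hf : ∀ i ∈ F, 0 < f i) :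
    ∃ c : ℝ, 0 < c ∧ ∀ i ∈ F, c ≤ f i := by
  rcases F.eq_empty_or_nonempty with rfl | hF
  · exact ⟨1, one_pos, by simp⟩
  · obtain ⟨i, hi, h⟩ := F.exists_min_image f hF
    exact ⟨f i, hf i hi, h⟩

section Spectral

open Module

variable {E : Type*} [NormedAddCommGroup E] [NormedSpace ℂ E] [FiniteDimensional ℂ E]
  (L : E →L[ℂ] E)

theorem spectrum_toLinearMap : spectrum ℂ L = spectrum ℂ (L : E →ₗ[ℂ] E) :=
  AlgEquiv.spectrum_eq (Module.End.toContinuousLinearMap (𝕜 := ℂ) E) (L : E →ₗ[ℂ] E)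

theorem finite_spectrum : (spectrum ℂ L).Finite := by
  rw [spectrum_toLinearMap]
  exact Module.End.finite_spectrum (L : E →ₗ[ℂ] E)

variable {L}

theorem mem_spectrum_of_mem_maxGenEigenspace {β : ℂ} {v : E}
    (hv : v ∈ End.maxGenEigenspace (L : E →ₗ[ℂ] E) β) (h0 : v ≠ 0) : β ∈ spectrum ℂ L := by
  rw [spectrum_toLinearMap]
  have h : End.HasUnifEigenvalue (L : E →ₗ[ℂ] E) β ⊤ := fun hbot => by
    rw [End.maxGenEigenspace, hbot] at hv
    exact h0 hv
  exact (h.lt zero_lt_one).mem_spectrum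

theorem ext_on_maxGenEigenspace {A B : E →L[ℂ] E}
    (h : ∀ β, ∀ v ∈ End.maxGenEigenspace (L : E →ₗ[ℂ] E) β, A v = B v) : A = B := by
  ext v
  have hv : v ∈ ⨆ β, End.maxGenEigenspace (L : E →ₗ[ℂ] E) β := by
    rw [End.iSup_maxGenEigenspace_eq_top]; trivial
  induction hv using Submodule.iSup_induction' with
  | mem β x hx => exact h β x hx
  | zero => simp
  | add x y _ _ hx hy => rw [map_add, map_add, hx, hy]

theorem spectralProj_mem (α : ℂ) (v : E) :
    spectralProj L α v ∈ End.maxGenEigenspace (L : E →ₗ[ℂ] E) α :=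
  Submodule.projection_apply_mem (isCompl_maxGenEigenspace L α) v

theorem spectralProj_apply_self {α : ℂ} {v : E}
    (hv : v ∈ End.maxGenEigenspace (L : E →ₗ[ℂ] E) α) : spectralProj L α v = v :=
  Submodule.projection_apply_of_mem_left (isCompl_maxGenEigenspace L α) hv

theorem spectralProj_apply_of_ne {α β : ℂ} (h : β ≠ α) {v : E}
    (hv : v ∈ End.maxGenEigenspace (L : E →ₗ[ℂ] E) β) : spectralProj L α v = 0 :=
  Submodule.projection_apply_of_mem_right (isCompl_maxGenEigenspace L α)
    (le_iSup₂_of_le (f := fun β (_ : β ≠ α) => End.maxGenEigenspace (L : E →ₗ[ℂ] E) β)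
      β h le_rfl hv)

theorem spectralProj_mul_self (α : ℂ) : spectralProj L α * spectralProj L α = spectralProj L α :=
  ContinuousLinearMap.ext fun v => spectralProj_apply_self (spectralProj_mem α v)

theorem spectralProj_mul_of_ne {α β : ℂ} (h : β ≠ α) :
    spectralProj L α * spectralProj L β = 0 :=
  ContinuousLinearMap.ext fun v => spectralProj_apply_of_ne h (spectralProj_mem β v)

theorem spectralProj_comm (α : ℂ) : spectralProj L α * L = L * spectralProj L α := by
  refine ext_on_maxGenEigenspace (L := L) fun β v hv => ?_
  have hLv : L v ∈ End.maxGenEigenspace (L : E →ₗ[ℂ] E) β :=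
    End.mapsTo_maxGenEigenspace_of_comm (Commute.refl (L : E →ₗ[ℂ] E)) β hv
  change spectralProj L α (L v) = L (spectralProj L α v)
  by_cases h : β = α
  · subst h
    rw [spectralProj_apply_self hLv, spectralProj_apply_self hv]
  · rw [spectralProj_apply_of_ne h hLv, spectralProj_apply_of_ne h hv, map_zero]

theorem sum_spectralProj : ∑ α ∈ (finite_spectrum L).toFinset, spectralProj L α = 1 := by
  refine ext_on_maxGenEigenspace (L := L) fun β v hv => ?_
  rw [_root_.sum_apply, one_apply_eq_self]
  by_cases h0 : v = 0
  · simp [h0]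
  · rw [Finset.sum_eq_single β (fun α _ hα => spectralProj_apply_of_ne hα.symm hv)
      (fun hβ => absurd (mem_spectrum_of_mem_maxGenEigenspace hv h0) (by simpa using hβ)),
      spectralProj_apply_self hv]

theorem pow_mul_spectralProj (α : ℂ) :
    (L - algebraMap ℂ (E →L[ℂ] E) α) ^ finrank ℂ E * spectralProj L α = 0 := by
  ext v
  have h := spectralProj_mem (L := L) α v
  rw [End.maxGenEigenspace_eq_genEigenspace_finrank, End.mem_genEigenspace_nat,
    LinearMap.mem_ker] at h
  have e : ((L - algebraMap ℂ (E →L[ℂ] E) α) ^ finrank ℂ E : E →L[ℂ] E) (spectralProj L α v) =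
      (((L : E →ₗ[ℂ] E) - α • (1 : End ℂ E)) ^ finrank ℂ E) (spectralProj L α v) := by
    rw [FunLike.coe_pow_eq_iterate, Module.End.coe_pow]
    congr 1
  change ((L - algebraMap ℂ (E →L[ℂ] E) α) ^ finrank ℂ E : E →L[ℂ] E) (spectralProj L α v) = 0
  rw [e, h]

theorem mem_peripheralEigenvalues {α : ℂ} :
    α ∈ peripheralEigenvalues L ↔ α ∈ spectrum ℂ L ∧ α.re = 0 := by
  simp [peripheralEigenvalues, peripheralSpectrum]

theorem nonperipheralProj_eq_sum : nonperipheralProj L =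
    ∑ α ∈ (finite_spectrum L).toFinset with α.re ≠ 0, spectralProj L α := by
  have h : peripheralEigenvalues L = (finite_spectrum L).toFinset.filter fun α => α.re = 0 := by
    ext α
    simp [mem_peripheralEigenvalues]
  rw [nonperipheralProj, peripheralProj, ← sum_spectralProj (L := L), h,
    ← Finset.sum_filter_add_sum_filter_not _ (fun α : ℂ => α.re = 0), add_sub_cancel_left]

theorem peripheralProj_comm : peripheralProj L * L = L * peripheralProj L := by
  simp only [peripheralProj, Finset.sum_mul, Finset.mul_sum, spectralProj_comm]

theorem peripheralProj_mul_spectralProj {α : ℂ} (hα : α ∈ peripheralEigenvalues L) :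
    peripheralProj L * spectralProj L α = spectralProj L α := by
  rw [peripheralProj, Finset.sum_mul, Finset.sum_eq_single α
    (fun β _ hβ => spectralProj_mul_of_ne hβ.symm) (fun h => absurd hα h), spectralProj_mul_self]

theorem peripheralProj_mul_zenoGenerator (D : E →L[ℂ] E) :
    peripheralProj L * zenoGenerator L D = zenoGenerator L D := by
  rw [zenoGenerator, Finset.mul_sum]
  refine Finset.sum_congr rfl fun α hα => ?_
  rw [← mul_assoc, ← mul_assoc, peripheralProj_mul_spectralProj hα]

theorem decayRate_ne_zero : decayRate L ≠ 0 := by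
  obtain ⟨c, hc, h⟩ := exists_pos_le_of_finset
    ((finite_spectrum L).toFinset.filter fun α => α.re ≠ 0) (fun α => |α.re|)
    fun α hα => abs_pos.2 (Finset.mem_filter.1 hα).2
  refine ne_of_gt (lt_of_lt_of_le (ENNReal.ofReal_pos.2 hc) ?_)
  exact le_iInf₂ fun α hα => le_iInf fun hre => ENNReal.ofReal_le_ofReal
    (h α (Finset.mem_filter.2 ⟨(finite_spectrum L).mem_toFinset.2 hα, hre⟩))

theorem nonperipheralProj_eq_zero_of_decayRate_eq_top (h : decayRate L = ⊤) :
    nonperipheralProj L = 0 := by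
  rw [nonperipheralProj_eq_sum]
  refine Finset.sum_eq_zero fun α hα => ?_
  rw [Finset.mem_filter, Set.Finite.mem_toFinset] at hα
  simp only [decayRate, iInf_eq_top, ENNReal.ofReal_ne_top] at h
  exact (h α hα.1 hα.2).elim

theorem peripheralGap_le {α β : ℂ} (hα : α ∈ peripheralEigenvalues L)
    (hβ : β ∈ peripheralEigenvalues L) (hne : α ≠ β) :
    0 < (peripheralGap L).toReal ∧ (peripheralGap L).toReal ≤ ‖α - β‖ := by
  have hle : peripheralGap L ≤ ENNReal.ofReal ‖α - β‖ :=
    (iInf₂_le α hα).trans ((iInf₂_le β hβ).trans (iInf_le _ hne))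
  obtain ⟨c, hc, h⟩ := exists_pos_le_of_finset (peripheralEigenvalues L).offDiag
    (fun p => ‖p.1 - p.2‖) fun p hp =>
      norm_pos_iff.2 (sub_ne_zero.2 (Finset.mem_offDiag.1 hp).2.2)
  have hge : ENNReal.ofReal c ≤ peripheralGap L :=
    le_iInf₂ fun a ha => le_iInf₂ fun b hb => le_iInf fun hab =>
      ENNReal.ofReal_le_ofReal (h (a, b) (Finset.mem_offDiag.2 ⟨ha, hb, hab⟩))
  have hpos := (ENNReal.ofReal_pos.2 hc).trans_le hge
  exact ⟨ENNReal.toReal_pos hpos.ne' (ne_top_of_le_ne_top ENNReal.ofReal_ne_top hle),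
    ENNReal.toReal_le_of_le_ofReal (norm_nonneg _) hle⟩

/-- The solution `X` of `[L, X] = P_φ D P_φ - D_Z` built from the peripheral spectral
projections. -/
noncomputable def peripheralCommutant (L D : E →L[ℂ] E) : E →L[ℂ] E :=
  ∑ p ∈ (peripheralEigenvalues L).offDiag,
    (p.1 - p.2)⁻¹ • (spectralProj L p.1 * D * spectralProj L p.2)

theorem norm_spectralProj_le {α : ℂ} (hα : α ∈ peripheralEigenvalues L) :
    ‖spectralProj L α‖ ≤ maxProjNorm L :=
  Finset.le_sup (f := fun α => ‖spectralProj L α‖₊) hα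

theorem norm_peripheralCommutant_le (D : E →L[ℂ] E) :
    ‖peripheralCommutant L D‖ ≤ (numPeripheral L : ℝ) * ((numPeripheral L : ℝ) - 1) /
      (peripheralGap L).toReal * (maxProjNorm L : ℝ) ^ 2 * ‖D‖ := by
  have hcard : ((peripheralEigenvalues L).offDiag.card : ℝ) =
      (numPeripheral L : ℝ) * ((numPeripheral L : ℝ) - 1) := by
    rw [Finset.offDiag_card, numPeripheral, Nat.cast_sub (Nat.le_mul_self _), Nat.cast_mul]
    ring
  have h := Finset.sum_le_card_nsmul (peripheralEigenvalues L).offDiag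
    (fun p => ‖(p.1 - p.2)⁻¹ • (spectralProj L p.1 * D * spectralProj L p.2)‖)
    ((peripheralGap L).toReal⁻¹ * ((maxProjNorm L : ℝ) * ‖D‖ * maxProjNorm L)) ?_
  · refine (norm_sum_le _ _).trans (h.trans (le_of_eq ?_))
    rw [nsmul_eq_mul, hcard]
    ring
  · intro p hp
    obtain ⟨h1, h2, hne⟩ := Finset.mem_offDiag.1 hp
    obtain ⟨hpos, hle⟩ := peripheralGap_le h1 h2 hne
    rw [norm_smul, norm_inv]
    gcongr
    refine (norm_mul_le _ _).trans (mul_le_mul ((norm_mul_le _ _).trans ?_)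
      (norm_spectralProj_le h2) (norm_nonneg _) (by positivity))
    exact mul_le_mul_of_nonneg_right (norm_spectralProj_le h1) (norm_nonneg _)

theorem peripheralProj_mul_peripheralCommutant (D : E →L[ℂ] E) :
    peripheralProj L * peripheralCommutant L D = peripheralCommutant L D := by
  rw [peripheralCommutant, Finset.mul_sum]
  refine Finset.sum_congr rfl fun p hp => ?_
  rw [mul_smul_comm, ← mul_assoc, ← mul_assoc,
    peripheralProj_mul_spectralProj (Finset.mem_offDiag.1 hp).1]

theorem peripheralProj_mul_mul_sub_zenoGenerator (D : E →L[ℂ] E) :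
    peripheralProj L * D * peripheralProj L - zenoGenerator L D =
      ∑ p ∈ (peripheralEigenvalues L).offDiag, spectralProj L p.1 * D * spectralProj L p.2 := by
  rw [sub_eq_iff_eq_add, zenoGenerator, ← Finset.sum_diag (peripheralEigenvalues L)
    (fun p : ℂ × ℂ => spectralProj L p.1 * D * spectralProj L p.2), add_comm,
    ← Finset.sum_union (Finset.disjoint_diag_offDiag _), Finset.diag_union_offDiag,
    Finset.sum_product, peripheralProj, Finset.sum_mul, Finset.sum_mul]
  simp only [Finset.mul_sum]

section Contraction

theorem mul_spectralProj_of_peripheral (hL : IsContractionGenerator L) {α : ℂ}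
    (hα : α ∈ peripheralEigenvalues L) :
    L * spectralProj L α = α • spectralProj L α := by
  have : CompleteSpace E := FiniteDimensional.complete ℂ E
  have h := mul_eq_zero_of_pow_mul_eq_zero (L := L) hL (mem_peripheralEigenvalues.1 hα).2
    (pow_mul_spectralProj (L := L) α)
  rwa [sub_mul, ← Algebra.smul_def, sub_eq_zero] at h

theorem exp_mul_spectralProj_of_peripheral (hL : IsContractionGenerator L) {α : ℂ}
    (hα : α ∈ peripheralEigenvalues L) (c : ℂ) :
    NormedSpace.exp (c • L) * spectralProj L α = Complex.exp (c * α) • spectralProj L α := by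
  have : CompleteSpace E := FiniteDimensional.complete ℂ E
  exact exp_smul_mul_of_eigen (mul_eq_zero_of_pow_mul_eq_zero (L := L) hL
    (mem_peripheralEigenvalues.1 hα).2 (pow_mul_spectralProj (L := L) α)) c

theorem exp_mul_peripheralProj (hL : IsContractionGenerator L) (c : ℂ) :
    NormedSpace.exp (c • L) * peripheralProj L =
    ∑ α ∈ peripheralEigenvalues L, Complex.exp (c * α) • spectralProj L α := by
  rw [peripheralProj, Finset.mul_sum]
  exact Finset.sum_congr rfl fun α hα => exp_mul_spectralProj_of_peripheral hL hα c

theorem commutator_peripheralCommutant (hL : IsContractionGenerator L) (D : E →L[ℂ] E) :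
    L * peripheralCommutant L D - peripheralCommutant L D * L =
      peripheralProj L * D * peripheralProj L - zenoGenerator L D := by
  rw [peripheralProj_mul_mul_sub_zenoGenerator, peripheralCommutant, Finset.mul_sum,
    Finset.sum_mul, ← Finset.sum_sub_distrib]
  refine Finset.sum_congr rfl fun p hp => ?_
  obtain ⟨h1, h2, hne⟩ := Finset.mem_offDiag.1 hp
  rw [mul_smul_comm, smul_mul_assoc, ← smul_sub, ← mul_assoc, ← mul_assoc,
    mul_spectralProj_of_peripheral hL h1, mul_assoc _ (spectralProj L p.2) L, spectralProj_comm,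
    mul_spectralProj_of_peripheral hL h2, smul_mul_assoc, smul_mul_assoc, mul_smul_comm,
    ← sub_smul, smul_smul, inv_mul_cancel₀ (sub_ne_zero.2 hne), one_smul]

theorem zenoGenerator_comm (hL : IsContractionGenerator L) (D : E →L[ℂ] E) :
    zenoGenerator L D * L = L * zenoGenerator L D := by
  rw [zenoGenerator, Finset.mul_sum, Finset.sum_mul]
  refine Finset.sum_congr rfl fun α hα => ?_
  rw [mul_assoc, spectralProj_comm, mul_spectralProj_of_peripheral hL hα, ← mul_assoc, ← mul_assoc,
    mul_spectralProj_of_peripheral hL hα, mul_smul_comm, smul_mul_assoc, smul_mul_assoc]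

theorem integrableOn_norm_exp_mul_nonperipheralProj (hL : IsContractionGenerator L) :
    IntegrableOn (fun s : ℝ => ‖NormedSpace.exp ((s : ℂ) • L) * nonperipheralProj L‖)
      (Set.Ioi 0) := by
  have : CompleteSpace E := FiniteDimensional.complete ℂ E
  have hi : IntegrableOn (fun s : ℝ => ∑ α ∈ (finite_spectrum L).toFinset with α.re ≠ 0,
      ‖NormedSpace.exp ((s : ℂ) • L) * spectralProj L α‖) (Set.Ioi 0) := by
    refine integrable_finsetSum _ fun α hα => ?_
    by_cases h0 : spectralProj L α = 0
    · simp [h0]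
    · have h := re_nonpos_of_pow_mul_eq_zero (L := L) hL h0 (pow_mul_spectralProj α)
      exact integrableOn_norm_exp_smul_mul (lt_of_le_of_ne h (Finset.mem_filter.1 hα).2)
        (pow_mul_spectralProj α)
  refine Integrable.mono' hi (continuous_norm_exp_smul_mul _ _).aestronglyMeasurable
    (Eventually.of_forall fun s => ?_)
  rw [norm_norm, nonperipheralProj_eq_sum, Finset.mul_sum]
  exact norm_sum_le _ _

theorem exists_isDecayConstant (hL : IsContractionGenerator L) :
    ∃ R : ℝ≥0, IsDecayConstant L R := by
  by_cases h : decayRate L = ⊤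
  · refine ⟨0, ?_⟩
    simp only [IsDecayConstant, nonperipheralProj_eq_zero_of_decayRate_eq_top h, mul_zero]
    refine (lintegral_eq_zero_of_ae_eq_zero (Eventually.of_forall fun _ => ?_)).le.trans zero_le
    change ((‖(0 : E →L[ℂ] E)‖₊ : ℝ≥0∞)) = 0
    rw [nnnorm_zero, ENNReal.coe_zero]
  · have hfin := (integrableOn_norm_exp_mul_nonperipheralProj hL).2
    rw [HasFiniteIntegral] at hfin
    simp only [enorm_norm] at hfin
    refine ⟨((∫⁻ s in Set.Ioi (0 : ℝ),
      ‖NormedSpace.exp ((s : ℂ) • L) * nonperipheralProj L‖ₑ) * decayRate L).toNNReal, ?_⟩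
    rw [IsDecayConstant, ENNReal.coe_toNNReal (ENNReal.mul_ne_top hfin.ne h),
      ENNReal.mul_div_cancel_right decayRate_ne_zero h]

theorem IsDecayConstant.integral_le {R : ℝ≥0} (hR : IsDecayConstant L R) {T : ℝ} (hT : 0 ≤ T) :
    ∫ s in (0 : ℝ)..T, ‖NormedSpace.exp ((s : ℂ) • L) * nonperipheralProj L‖ ≤
      ((R : ℝ≥0∞) / decayRate L).toReal := by
  have : CompleteSpace E := FiniteDimensional.complete ℂ E
  rw [intervalIntegral.integral_of_le hT,
    integral_norm_eq_lintegral_enorm]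
  · exact ENNReal.toReal_mono (ENNReal.div_ne_top ENNReal.coe_ne_top decayRate_ne_zero)
      ((lintegral_mono_set Set.Ioc_subset_Ioi_self).trans hR)
  · let _ : NormedAlgebra ℚ (E →L[ℂ] E) := NormedAlgebra.restrictScalars ℚ ℂ (E →L[ℂ] E)
    exact (((NormedSpace.exp_continuous).comp
      (by fun_prop : Continuous fun s : ℝ => (s : ℂ) • L)).mul
        continuous_const).aestronglyMeasurable

theorem norm_peripheralProj_le (hL : IsContractionGenerator L) : ‖peripheralProj L‖ ≤ 1 := by
  have : CompleteSpace E := FiniteDimensional.complete ℂ E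
  obtain ⟨R, hR⟩ := exists_isDecayConstant hL
  obtain ⟨ψ, hψ, hrec⟩ := exists_tendsto_exp_nat_mul (peripheralEigenvalues L)
    fun α hα => (mem_peripheralEigenvalues.1 hα).2
  have h1 : Tendsto (fun j => NormedSpace.exp ((((ψ j : ℕ) : ℝ) : ℂ) • L) * nonperipheralProj L)
      atTop (𝓝 0) :=
    (tendsto_exp_smul_mul_zero (L := L) hL fun T hT => hR.integral_le hT).comp
      (tendsto_natCast_atTop_atTop.comp hψ)
  have h2 : Tendsto (fun j => NormedSpace.exp ((((ψ j : ℕ) : ℝ) : ℂ) • L) * peripheralProj L)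
      atTop (𝓝 (peripheralProj L)) := by
    simp only [exp_mul_peripheralProj hL, Complex.ofReal_natCast]
    rw [peripheralProj]
    exact tendsto_finsetSum _ fun α hα => by simpa using (hrec α hα).smul_const (spectralProj L α)
  have h3 : Tendsto (fun j => NormedSpace.exp ((((ψ j : ℕ) : ℝ) : ℂ) • L))
      atTop (𝓝 (peripheralProj L)) := by
    have := h2.add h1
    simpa only [← mul_add, nonperipheralProj, add_sub_cancel, mul_one, add_zero] using this
  exact le_of_tendsto h3.norm (Eventually.of_forall fun j => hL _ (Nat.cast_nonneg _))

theorem norm_conj_peripheralCommutant_le (hL : IsContractionGenerator L) (D : E →L[ℂ] E)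
    {τ : ℝ} (hτ : 0 ≤ τ) :
    ‖NormedSpace.exp (-((τ : ℂ) • L)) * peripheralCommutant L D *
        NormedSpace.exp ((τ : ℂ) • L)‖ ≤
      (∑ α ∈ peripheralEigenvalues L, ‖spectralProj L α‖) * ‖peripheralCommutant L D‖ := by
  have h1 : ‖NormedSpace.exp (-((τ : ℂ) • L)) * peripheralProj L‖ ≤
      ∑ α ∈ peripheralEigenvalues L, ‖spectralProj L α‖ := by
    rw [← neg_smul, exp_mul_peripheralProj hL]
    refine norm_sum_le_of_le _ fun α hα => ?_
    rw [norm_smul, Complex.norm_exp]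
    simp [(mem_peripheralEigenvalues.1 hα).2]
  refine (norm_mul_le _ _).trans ((mul_le_of_le_one_right (norm_nonneg _) (hL τ hτ)).trans ?_)
  nth_rw 1 [← peripheralProj_mul_peripheralCommutant]
  rw [← mul_assoc]
  exact (norm_mul_le _ _).trans (mul_le_mul_of_nonneg_right h1 (norm_nonneg _))

theorem norm_exp_sub_exp_zenoGenerator_le (hL : IsContractionGenerator L) (D : E →L[ℂ] E)
    {R : ℝ≥0} (hR : IsDecayConstant L R) {κ t : ℝ} (hκ : 0 < κ) (ht : 0 ≤ t) :
    ‖NormedSpace.exp ((t : ℂ) • ((κ : ℂ) • L + D)) -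
        NormedSpace.exp ((t : ℂ) • ((κ : ℂ) • L + zenoGenerator L D))‖ ≤
      2 / κ *
        ((numPeripheral L : ℝ) * ((numPeripheral L : ℝ) - 1) / (peripheralGap L).toReal *
            (maxProjNorm L : ℝ) ^ 2 +
          ((R : ℝ≥0∞) / decayRate L).toReal) *
        ‖D‖ * Real.exp (t * ‖zenoGenerator L D‖) *
        (1 + t * Real.exp (t * ‖D‖) * (‖D‖ + ‖zenoGenerator L D‖)) := by
  have : CompleteSpace E := FiniteDimensional.complete ℂ E
  exact norm_exp_sub_exp_le_of_complex hL (norm_peripheralProj_le hL) peripheralProj_comm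
    (peripheralProj_mul_zenoGenerator D) (commutator_peripheralCommutant hL D)
    (norm_peripheralCommutant_le D) (fun T hT => hR.integral_le hT) hκ ht

end Contraction

end Spectral

end StrongCoupling

open StrongCoupling

theorem corollary4 {E : Type*} [NormedAddCommGroup E] [NormedSpace ℂ E] [FiniteDimensional ℂ E]
    (L₀ D : E →L[ℂ] E) (hL₀ : IsContractionGenerator L₀) :
    -- the long-time average exists and equals the effective generator
    Tendsto (fun τ : ℝ => ((τ⁻¹ : ℝ) : ℂ) •
        ∫ s in (0 : ℝ)..τ, NormedSpace.exp (-((s : ℂ) • L₀)) * peripheralProj L₀ * D *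
          peripheralProj L₀ * NormedSpace.exp ((s : ℂ) • L₀))
      atTop (𝓝 (zenoGenerator L₀ D)) ∧
    -- the strong-coupling limit, uniformly on bounded time intervals
    (∀ T : ℝ, 0 ≤ T →
      TendstoUniformlyOn
        (fun (κ : ℝ) (t : ℝ) =>
          NormedSpace.exp ((t : ℂ) • ((κ : ℂ) • L₀ + D)) -
            NormedSpace.exp ((t : ℂ) • ((κ : ℂ) • L₀ + zenoGenerator L₀ D)))
        (fun _ => 0) atTop (Set.Icc 0 T)) ∧
    -- the error bound, for every admissible constant `R`, and there are such constants
    (∃ R : ℝ≥0, IsDecayConstant L₀ R) ∧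
    (∀ R : ℝ≥0, IsDecayConstant L₀ R → ∀ κ : ℝ, 0 < κ → ∀ t : ℝ, 0 ≤ t →
      ‖NormedSpace.exp ((t : ℂ) • ((κ : ℂ) • L₀ + D)) -
          NormedSpace.exp ((t : ℂ) • ((κ : ℂ) • L₀ + zenoGenerator L₀ D))‖ ≤
        2 / κ *
          ((numPeripheral L₀ : ℝ) * ((numPeripheral L₀ : ℝ) - 1) / (peripheralGap L₀).toReal *
              (maxProjNorm L₀ : ℝ) ^ 2 +
            ((R : ℝ≥0∞) / decayRate L₀).toReal) *
          ‖D‖ * Real.exp (t * ‖zenoGenerator L₀ D‖) *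
          (1 + t * Real.exp (t * ‖D‖) * (‖D‖ + ‖zenoGenerator L₀ D‖))) := by
  refine ⟨?_, fun T _ => ?_, exists_isDecayConstant hL₀, fun R hR κ hκ t ht =>
    norm_exp_sub_exp_zenoGenerator_le hL₀ D hR hκ ht⟩
  · have : CompleteSpace E := FiniteDimensional.complete ℂ E
    have h := tendsto_average_conj_exp (zenoGenerator_comm hL₀ D)
      (commutator_peripheralCommutant hL₀ D)
      fun τ hτ => norm_conj_peripheralCommutant_le hL₀ D hτ
    simpa only [mul_assoc] using h
  · obtain ⟨R, hR⟩ := exists_isDecayConstant hL₀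
    set C := (numPeripheral L₀ : ℝ) * ((numPeripheral L₀ : ℝ) - 1) / (peripheralGap L₀).toReal *
      (maxProjNorm L₀ : ℝ) ^ 2 + ((R : ℝ≥0∞) / decayRate L₀).toReal with hC
    have hC0 : 0 ≤ C := by
      have : (0 : ℝ) ≤ (numPeripheral L₀ : ℝ) * ((numPeripheral L₀ : ℝ) - 1) := by
        rcases Nat.eq_zero_or_pos (numPeripheral L₀) with h | h
        · simp [h]
        · have : (1 : ℝ) ≤ numPeripheral L₀ := by exact_mod_cast h
          exact mul_nonneg (by positivity) (by linarith)
      positivity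
    set K := 2 * C * ‖D‖ * Real.exp (T * ‖zenoGenerator L₀ D‖) *
      (1 + T * Real.exp (T * ‖D‖) * (‖D‖ + ‖zenoGenerator L₀ D‖)) with hK
    have hlim : Tendsto (fun κ : ℝ => K / κ) atTop (𝓝 0) :=
      tendsto_const_nhds.div_atTop tendsto_id
    rw [Metric.tendstoUniformlyOn_iff]
    intro ε hε
    filter_upwards [hlim.eventually (gt_mem_nhds hε), eventually_gt_atTop 0] with κ hκε hκ t ht
    rw [dist_zero_left]
    refine ((norm_exp_sub_exp_zenoGenerator_le hL₀ D hR hκ ht.1).trans ?_).trans_lt hκε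
    rw [← hC]
    have h1 : 2 / κ * C * ‖D‖ * Real.exp (t * ‖zenoGenerator L₀ D‖) *
        (1 + t * Real.exp (t * ‖D‖) * (‖D‖ + ‖zenoGenerator L₀ D‖)) ≤
        2 / κ * C * ‖D‖ * Real.exp (T * ‖zenoGenerator L₀ D‖) *
        (1 + T * Real.exp (T * ‖D‖) * (‖D‖ + ‖zenoGenerator L₀ D‖)) := by
      have ht0 := ht.1
      have htT := ht.2
      gcongr
    refine h1.trans (le_of_eq ?_)
    rw [hK]
    ring
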